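/- Let $\ell\ge 1$ be an integer, $\tau\in\mathbb C$ with $\operatorname{Im}\tau>0$, and $\eta\in\mathbb C$. Put $$\theta_1(x)=\theta_1(x|\tau)=\sum_{k\in\mathbb Z}\exp\Bigl(\pi i\tau(k+\tfrac12)^2+2\pi i(x+\tfrac12)(k+\tfrac12)\Bigr),\qquad [k]=\theta_1(2k\eta),\qquad \Phi(x,\zeta)=\frac{\theta_1(\zeta+x)}{\theta_1(x)\theta_1(\zeta)},$$ and assume that $[k]\neq 0$ for $1\le k\le 2\ell$. Let $\Lambda=\{1,\dots,\ell\}$, $N=\frac12\ell(\ell+1)$, and for $m,n\in\Lambda$ let $$G_{mn}(\zeta)=(-1)^{\ell+1}[2m]\Bigl(\prod_{j\in\Lambda,\,j\ne m}\frac{[m+j]}{[m-j]}\Bigr)\Phi\bigl(-2(m+n)\eta,\zeta\bigr).$$ For a subset $J\subseteq\Lambda$ let $|J|$ be its cardinality, $\|J\|=\sum_{m\in J}m$, and $\kappa(J)=|J|\ell+\frac12|J|(|J|-1)$. For $0\le j\le N$ define $$C_j^{(\ell)}(\eta)=\sum_{J\subseteq\Lambda,\ \|J\|=j}(-1)^{\kappa(J)+j}\prod_{k\in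 J}\ \prod_{k'\in\Lambda\setminus J}\frac{\theta_1(2(k+k')\eta)}{\theta_1(2(k-k')\eta)},$$ which depends only on $\ell$, $\eta$ and $\tau$. For all $\zeta,K\in\mathbb C$ with $\theta_1(\zeta)\ne0$, the equation of the curve $\Gamma_e$ in the variables $(\zeta,K)$, $$\det\bigl(K^{2m}\delta_{mn}+G_{mn}(\zeta)\bigr)_{1\le m,n\le\ell}=0,$$ is equivalent to $$\sum_{j=0}^{N}(-1)^jC_j^{(\ell)}(\eta)\,\theta_1(\zeta-4j\eta)\,K^{2(N-j)}=0;$$ more precisely, the left-hand side of the second equation is $\theta_1(\zeta)$ times the determinant in the first. Moreover $C_0^{(\ell)}(\eta)=1$ and $C_j^{(\ell)}(\eta)=C_{N-j}^{(\ell)}(\eta)$ for $0\le j\le N$. -/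

import Mathlib

open Complex

/-- The odd Jacobi theta function
`θ₁(x|τ) = ∑_{k ∈ ℤ} exp(π i τ (k + 1/2)² + 2 π i (x + 1/2)(k + 1/2))`.
The series converges absolutely for `Im τ > 0`. -/
noncomputable def theta1 (τ x : ℂ) : ℂ :=
  ∑' k : ℤ, cexp (Real.pi * I * τ * ((k : ℂ) + 1 / 2) ^ 2
    + 2 * Real.pi * I * (x + 1 / 2) * ((k : ℂ) + 1 / 2))

/-- The elliptic number `[k] = θ₁(2kη)`. -/
noncomputable def ellNum (τ η : ℂ) (k : ℤ) : ℂ := theta1 τ (2 * (k : ℂ) * η)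

/-- `Φ(x, ζ) = θ₁(ζ + x) / (θ₁(x) θ₁(ζ))`. -/
noncomputable def Phi (τ x ζ : ℂ) : ℂ :=
  theta1 τ (ζ + x) / (theta1 τ x * theta1 τ ζ)

/-- `G_{mn}(ζ) = (-1)^{ℓ+1} [2m] (∏_{j ≠ m, 1 ≤ j ≤ ℓ} [m+j]/[m-j]) Φ(-2(m+n)η, ζ)`. -/
noncomputable def Gentry (ℓ : ℕ) (τ η ζ : ℂ) (m n : ℕ) : ℂ :=
  (-1) ^ (ℓ + 1) * ellNum τ η (2 * (m : ℤ))
    * (∏ j ∈ (Finset.Icc 1 ℓ).erase m,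
        ellNum τ η ((m : ℤ) + (j : ℤ)) / ellNum τ η ((m : ℤ) - (j : ℤ)))
    * Phi τ (-2 * ((m : ℂ) + (n : ℂ)) * η) ζ

/-- The `ℓ × ℓ` matrix `(K^{2m} δ_{mn} + G_{mn}(ζ))_{1 ≤ m, n ≤ ℓ}`; the index `i : Fin ℓ`
stands for `m = i + 1`. -/
noncomputable def curveMatrix (ℓ : ℕ) (τ η ζ K : ℂ) : Matrix (Fin ℓ) (Fin ℓ) ℂ :=
  Matrix.of fun a b =>
    (if a = b then K ^ (2 * ((a : ℕ) + 1)) else 0)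
      + Gentry ℓ τ η ζ ((a : ℕ) + 1) ((b : ℕ) + 1)

/-- `N = ℓ(ℓ+1)/2` (the division is exact). -/
def bigN (ℓ : ℕ) : ℕ := ℓ * (ℓ + 1) / 2

/-- `κ(J) = |J| ℓ + |J|(|J|-1)/2` (the division is exact, and the second term is `0` for `J = ∅`). -/
def kappa (ℓ : ℕ) (J : Finset ℕ) : ℕ := J.card * ℓ + J.card * (J.card - 1) / 2

/-- `C_j^{(ℓ)}(η) = ∑_{J ⊆ Λ, ‖J‖ = j} (-1)^{κ(J)+j} ∏_{k ∈ J} ∏_{k' ∈ Λ∖J} [k+k']/[k-k']`,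
where `Λ = {1, …, ℓ}` and `‖J‖` is the sum of the elements of `J`. -/
noncomputable def curveCoeff (ℓ : ℕ) (τ η : ℂ) (j : ℕ) : ℂ :=
  ∑ J ∈ (Finset.Icc 1 ℓ).powerset with ∑ m ∈ J, m = j,
    (-1) ^ (kappa ℓ J + j)
      * ∏ k ∈ J, ∏ k' ∈ Finset.Icc 1 ℓ \ J,
          ellNum τ η ((k : ℤ) + (k' : ℤ)) / ellNum τ η ((k : ℤ) - (k' : ℤ))

/-- `∑_{j=0}^{N} (-1)^j C_j^{(ℓ)}(η) θ₁(ζ - 4jη) K^{2(N-j)}`. -/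
noncomputable def curvePoly (ℓ : ℕ) (τ η ζ K : ℂ) : ℂ :=
  ∑ j ∈ Finset.range (bigN ℓ + 1),
    (-1) ^ j * curveCoeff ℓ τ η j * theta1 τ (ζ - 4 * (j : ℂ) * η) * K ^ (2 * (bigN ℓ - j))

/-! Expanding the determinant along its diagonal part gives a sum over J ⊆ Λ of principal minors of
G, each times K^{2(N-‖J‖)}, the product of the diagonal entries outside J
(`det_diagonal_add_eq_sum_minors`). Once row factors are pulled out, a minor is a Frobenius
(elliptic Cauchy) determinant at the points 2mη, m ∈ J, so ζ enters it only through θ₁(ζ -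
4‖J‖η)/θ₁(ζ) (`theta1_mul_det_cauchy`, `theta1_mul_det_minor`). The Cauchy factors inside J cancel
against the row factors, leaving the products over J × (Λ∖J) that define C_j; grouping by ‖J‖ gives
the polynomial.

The Frobenius determinant follows by induction on its size through Schur complements. The induction
step is the 2 × 2 case, a form of the Weierstrass three-term identity, which is a Plücker relation
between theta series of modulus 2τ. The symmetry of C_j comes from J ↦ Λ∖J. -/

/-! ### Convergence, analyticity and oddness of θ₁ -/

/-- The general term of the series defining `theta1`. -/
noncomputable def theta1Term (τ x : ℂ) (k : ℤ) : ℂ :=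
  cexp (Real.pi * I * τ * ((k : ℂ) + 1 / 2) ^ 2
    + 2 * Real.pi * I * (x + 1 / 2) * ((k : ℂ) + 1 / 2))

theorem theta1_eq_tsum (τ x : ℂ) : theta1 τ x = ∑' k : ℤ, theta1Term τ x k := rfl

theorem theta1Term_eq (τ x : ℂ) (k : ℤ) :
    theta1Term τ x k = cexp (Real.pi * I * τ / 4 + Real.pi * I * (x + 1 / 2))
      * jacobiTheta₂_term k (x + 1 / 2 + τ / 2) τ := by
  rw [theta1Term, jacobiTheta₂_term, ← Complex.exp_add]
  congr 1
  ring

theorem summable_theta1Term {τ : ℂ} (hτ : 0 < τ.im) (x : ℂ) : Summable (theta1Term τ x) := by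
  have h := ((hasSum_jacobiTheta₂_term (x + 1 / 2 + τ / 2) hτ).summable).mul_left
    (cexp (Real.pi * I * τ / 4 + Real.pi * I * (x + 1 / 2)))
  exact h.congr fun k => (theta1Term_eq τ x k).symm

theorem theta1_eq_jacobiTheta₂ (τ x : ℂ) :
    theta1 τ x = cexp (Real.pi * I * τ / 4 + Real.pi * I * (x + 1 / 2))
      * jacobiTheta₂ (x + 1 / 2 + τ / 2) τ := by
  rw [theta1_eq_tsum, jacobiTheta₂, ← tsum_mul_left]
  exact tsum_congr (theta1Term_eq τ x)

theorem differentiable_theta1 {τ : ℂ} (hτ : 0 < τ.im) : Differentiable ℂ (theta1 τ) := by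
  have h : theta1 τ = fun x => cexp (Real.pi * I * τ / 4 + Real.pi * I * (x + 1 / 2))
      * jacobiTheta₂ (x + 1 / 2 + τ / 2) τ := funext (theta1_eq_jacobiTheta₂ τ)
  rw [h]
  intro x
  have h2 : DifferentiableAt ℂ (fun x : ℂ => x + 1 / 2 + τ / 2) x := by fun_prop
  have h3 : DifferentiableAt ℂ (fun x : ℂ => jacobiTheta₂ (x + 1 / 2 + τ / 2) τ) x :=
    DifferentiableAt.comp (g := fun z => jacobiTheta₂ z τ) x
      (differentiableAt_jacobiTheta₂_fst (x + 1 / 2 + τ / 2) hτ) h2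
  exact DifferentiableAt.mul (by fun_prop) h3

/-- The reindexing k ↦ -k - 1 negates k + 1/2; the shift of x by 1/2 then contributes exp(πi · odd)
= -1. -/
theorem theta1_neg (τ x : ℂ) : theta1 τ (-x) = -theta1 τ x := by
  rw [theta1_eq_tsum, theta1_eq_tsum, ← tsum_neg,
    ← ((Equiv.neg ℤ).trans (Equiv.subRight 1)).tsum_eq]
  refine tsum_congr fun k => ?_
  have h : cexp (Real.pi * I * τ * ((k : ℂ) + 1 / 2) ^ 2
      + 2 * Real.pi * I * (x + 1 / 2) * ((k : ℂ) + 1 / 2) + (Real.pi * I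
      + (-k - 1 : ℤ) * (2 * Real.pi * I))) = -theta1Term τ x k := by
    rw [Complex.exp_add, Complex.exp_add (Real.pi * I), Complex.exp_int_mul_two_pi_mul_I,
      Complex.exp_pi_mul_I, theta1Term]
    ring
  rw [← h, theta1Term]
  congr 1
  simp only [Equiv.trans_apply, Equiv.neg_apply, Equiv.subRight_apply]
  push_cast
  ring

/-- The general term of the theta series of modulus `2τ` with characteristic `s / 2`. -/
noncomputable def doubledTerm (τ s x : ℂ) (p : ℤ) : ℂ :=
  cexp (Real.pi * I * τ * (2 * (p : ℂ) + s) ^ 2 / 2 + 2 * Real.pi * I * x * (2 * (p : ℂ) + s))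

/-- The theta series of modulus `2τ` with characteristic `s / 2`. -/
noncomputable def doubledTheta (τ s x : ℂ) : ℂ := ∑' p : ℤ, doubledTerm τ s x p

theorem summable_doubledTerm {τ : ℂ} (hτ : 0 < τ.im) (s x : ℂ) :
    Summable (doubledTerm τ s x) := by
  have hτ2 : 0 < (2 * τ).im := by simpa using hτ
  have h := ((hasSum_jacobiTheta₂_term (2 * x + s * τ) hτ2).summable).mul_left
    (cexp (Real.pi * I * τ * s ^ 2 / 2 + 2 * Real.pi * I * x * s))
  refine h.congr fun k => ?_
  rw [doubledTerm, jacobiTheta₂_term, ← Complex.exp_add]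
  congr 1
  ring

theorem hasSum_mul_of_summable {f g : ℤ → ℂ} (hf : Summable f) (hg : Summable g) :
    HasSum (fun z : ℤ × ℤ => f z.1 * g z.2) ((∑' k, f k) * ∑' k, g k) := by
  rw [tsum_mul_tsum_of_summable_norm hf.norm hg.norm]
  exact (summable_mul_of_summable_norm hf.norm hg.norm).hasSum

/-- The double series over (k, l) is split by the parity of k + l. In the coordinates k + l + 1 and
k - l the quadratic form becomes diagonal, and the half shifts give the sign (-1)^{k+l+1}: plus on
the range of `g₁`, minus on that of `g₂`. -/
theorem theta1_add_mul_theta1_sub {τ : ℂ} (hτ : 0 < τ.im) (x y : ℂ) :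
    theta1 τ (x + y) * theta1 τ (x - y) =
      doubledTheta τ 0 x * doubledTheta τ 1 y - doubledTheta τ 1 x * doubledTheta τ 0 y := by
  set f : ℤ × ℤ → ℂ := fun z => theta1Term τ (x + y) z.1 * theta1Term τ (x - y) z.2 with hf
  have hsum : HasSum f (theta1 τ (x + y) * theta1 τ (x - y)) :=
    hasSum_mul_of_summable (summable_theta1Term hτ _) (summable_theta1Term hτ _)
  let g₁ : ℤ × ℤ → ℤ × ℤ := fun z => (z.1 + z.2, z.1 - z.2 - 1)
  let g₂ : ℤ × ℤ → ℤ × ℤ := fun z => (z.1 + z.2, z.1 - z.2)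
  have hg₁ : Function.Injective g₁ := by
    rintro ⟨a, b⟩ ⟨c, d⟩ h
    simp only [g₁, Prod.mk.injEq] at h ⊢
    omega
  have hg₂ : Function.Injective g₂ := by
    rintro ⟨a, b⟩ ⟨c, d⟩ h
    simp only [g₂, Prod.mk.injEq] at h ⊢
    omega
  have hcompl : IsCompl (Set.range g₁) (Set.range g₂) := by
    refine ⟨?_, codisjoint_iff.2 ?_⟩
    · rw [Set.disjoint_left]
      rintro _ ⟨⟨a, b⟩, rfl⟩ ⟨⟨c, d⟩, h⟩
      simp only [g₁, g₂, Prod.mk.injEq] at h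
      omega
    · refine Set.eq_univ_of_forall ?_
      rintro ⟨k, l⟩
      rcases Int.even_or_odd (k + l) with ⟨p, hp⟩ | ⟨p, hp⟩
      · exact Or.inr ⟨(p, k - p), by simp only [g₂, Prod.mk.injEq]; omega⟩
      · exact Or.inl ⟨(p + 1, k - p - 1), by simp only [g₁, Prod.mk.injEq]; omega⟩
  have h₁ : HasSum (f ∘ g₁) (doubledTheta τ 0 x * doubledTheta τ 1 y) := by
    have h := hasSum_mul_of_summable (summable_doubledTerm hτ 0 x) (summable_doubledTerm hτ 1 y)
    refine h.congr_fun fun z => ?_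
    have e : ∀ w : ℂ, cexp w = cexp (w + (-z.1 : ℤ) * (2 * Real.pi * I)) := fun w => by
      rw [Complex.exp_add, Complex.exp_int_mul_two_pi_mul_I, mul_one]
    simp only [Function.comp, hf, g₁, theta1Term, doubledTerm]
    rw [← Complex.exp_add, ← Complex.exp_add, e (_ + _ + _)]
    congr 1
    push_cast
    ring
  have h₂ : HasSum (f ∘ g₂) (-(doubledTheta τ 1 x * doubledTheta τ 0 y)) := by
    have h := (hasSum_mul_of_summable (summable_doubledTerm hτ 1 x)
      (summable_doubledTerm hτ 0 y)).neg
    refine h.congr_fun fun z => ?_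
    have e : ∀ w : ℂ, -cexp w = cexp (w + (Real.pi * I + (z.1 : ℤ) * (2 * Real.pi * I))) :=
      fun w => by
        rw [Complex.exp_add, Complex.exp_add, Complex.exp_int_mul_two_pi_mul_I,
          Complex.exp_pi_mul_I]
        ring
    simp only [Function.comp, hf, g₂, theta1Term, doubledTerm]
    rw [← Complex.exp_add, ← Complex.exp_add, e (_ + _ )]
    congr 1
    push_cast
    ring
  have h := HasSum.add_isCompl (f := f) hcompl ((hg₁.hasSum_range_iff).2 h₁)
    ((hg₂.hasSum_range_iff).2 h₂)
  rw [hsum.unique h, sub_eq_add_neg]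

/-- The Weierstrass three-term identity. -/
theorem theta1_three_term {τ : ℂ} (hτ : 0 < τ.im) (p q r s : ℂ) :
    theta1 τ (p + q) * theta1 τ (p - q) * (theta1 τ (r + s) * theta1 τ (r - s))
      - theta1 τ (p + r) * theta1 τ (p - r) * (theta1 τ (q + s) * theta1 τ (q - s))
      + theta1 τ (p + s) * theta1 τ (p - s) * (theta1 τ (q + r) * theta1 τ (q - r)) = 0 := by
  -- Each product becomes a 2 × 2 minor of the vectors (Θ₀, Θ₁) at p, q, r, s, so the claim is the
  -- Plücker relation.
  simp only [theta1_add_mul_theta1_sub hτ]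
  ring

/-- The `2 × 2` case of Frobenius' elliptic Cauchy determinant, without denominators. -/
theorem theta1_frobenius_two {τ : ℂ} (hτ : 0 < τ.im) (ζ x X y Y : ℂ) :
    theta1 τ (ζ + x - y) * theta1 τ (ζ + X - Y) * (theta1 τ (x - Y) * theta1 τ (X - y))
      - theta1 τ (ζ + x - Y) * theta1 τ (ζ + X - y) * (theta1 τ (x - y) * theta1 τ (X - Y))
      = theta1 τ ζ * theta1 τ (ζ + x + X - y - Y) * (theta1 τ (x - X) * theta1 τ (Y - y)) := by
  -- These values solve p + q = ζ + x - y, p - q = ζ + X - Y, r + s = x - Y, r - s = y - X; then p -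
  -- s = ζ. Oddness corrects the remaining signs.
  have h := theta1_three_term hτ (ζ + (x + X - y - Y) / 2) ((x - X - y + Y) / 2)
    ((x - X + y - Y) / 2) ((x + X - y - Y) / 2)
  have h1 := theta1_neg τ (X - y)
  have h2 := theta1_neg τ (X - Y)
  ring_nf at h h1 h2 ⊢
  rw [h1, h2] at h
  linear_combination -h

/-! ### Density and determinant expansions -/

/-- By the identity theorem, an entire function that is not identically zero cannot vanish on an
open set. -/
theorem dense_theta1_ne_zero {τ : ℂ} (hτ : 0 < τ.im) {w : ℂ} (hw : theta1 τ w ≠ 0) (a : ℂ) :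
    Dense {ζ : ℂ | theta1 τ (ζ + a) ≠ 0} := by
  have hd : Differentiable ℂ fun ζ => theta1 τ (ζ + a) :=
    (differentiable_theta1 hτ).comp (differentiable_id.add_const a)
  have han : AnalyticOnNhd ℂ (fun ζ => theta1 τ (ζ + a)) Set.univ :=
    fun z _ => hd.analyticAt z
  intro z
  rw [mem_closure_iff_frequently]
  by_contra hcon
  have hev : ∀ᶠ ζ in nhds z, theta1 τ (ζ + a) = 0 := by
    exact (Filter.not_frequently.1 hcon).mono fun _ h => not_not.1 h
  have h0 := han.eqOn_zero_of_preconnected_of_eventuallyEq_zero isPreconnected_univ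
    (Set.mem_univ z) hev
  refine hw ?_
  simpa using h0 (Set.mem_univ (w - a))

/-- Multilinearity in the rows: s records the rows taken from M, and the other rows are multiples of
unit vectors. -/
theorem det_diagonal_add_eq_sum_minors {n R : Type*} [Fintype n] [DecidableEq n] [CommRing R]
    (d : n → R) (M : Matrix n n R) :
    (Matrix.diagonal d + M).det = ∑ s : Finset n,
      (M.submatrix (Subtype.val : s → n) (Subtype.val : s → n)).det * ∏ i ∈ sᶜ, d i := by
  have h := (Matrix.detRowAlternating : (n → R) [⋀^n]→ₗ[R] R).map_add_univ
    (fun i => M i) (fun i => Matrix.diagonal d i)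
  have h0 : (Matrix.diagonal d + M).det = (Matrix.detRowAlternating : (n → R) [⋀^n]→ₗ[R] R)
      ((fun i => M i) + fun i => Matrix.diagonal d i) := by
    rw [add_comm]
    rfl
  rw [h0, h]
  refine Finset.sum_congr rfl fun s _ => ?_
  have hs : s.piecewise (fun i => M i) (fun i => Matrix.diagonal d i) =
      fun i => (if i ∈ s then 1 else d i) •
        s.piecewise (fun i => M i) (fun i => (1 : Matrix n n R) i) i := by
    funext i j
    by_cases hi : i ∈ s <;> simp [hi, Matrix.diagonal_apply, Matrix.one_apply]
  rw [hs, AlternatingMap.map_smul_univ, ← Matrix.det_piecewise_one_eq_submatrix_det, smul_eq_mul,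
    mul_comm]
  congr 1
  rw [Finset.prod_ite]
  simp only [Finset.prod_const_one, one_mul]
  refine Finset.prod_congr ?_ fun _ _ => rfl
  ext i
  simp

/-- Schur complement of the 1 × 1 block at `none`. -/
theorem det_option {ι K : Type*} [Fintype ι] [DecidableEq ι] [DecidableEq (Option ι)] [Field K]
    (M : Matrix (Option ι) (Option ι) K) (h : M none none ≠ 0) :
    M.det = M none none * (Matrix.of fun i j : ι => M (some i) (some j)
      - M (some i) none * M none (some j) / M none none).det := by
  let e := (Equiv.optionEquivSumPUnit.{0} ι).symm
  let D : Matrix PUnit.{1} PUnit.{1} K := Matrix.of fun _ _ => M none none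
  have hD : D.det = M none none := by simp [D]
  have : Invertible D := Matrix.invertibleOfIsUnitDet D (by rw [hD]; exact h.isUnit)
  have hinv : ⅟D = Matrix.of fun _ _ => (M none none)⁻¹ := by
    rw [invOf_eq_right_inv]
    ext i j
    simp [D, Matrix.mul_apply, h]
  have hM : M.submatrix e e = Matrix.fromBlocks (Matrix.of fun i j : ι => M (some i) (some j))
      (Matrix.of fun i _ => M (some i) none) (Matrix.of fun _ j => M none (some j)) D := by
    ext (i | i) (j | j) <;> rfl
  rw [← Matrix.det_submatrix_equiv_self e M, hM, Matrix.det_fromBlocks₂₂, hD, hinv]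
  congr 2
  ext i j
  simp [Matrix.mul_apply, div_eq_mul_inv]
  ring

/-! ### The elliptic Cauchy determinant -/

/-- Frobenius' elliptic Cauchy determinant at the symmetric points `x = -u`, `y = u`, with the
denominators `θ₁(ζ)` cleared. -/
theorem theta1_mul_det_cauchy {τ : ℂ} (hτ : 0 < τ.im) {w : ℂ} (hw : theta1 τ w ≠ 0)
    (ι : Type) [Fintype ι] : ∀ [DecidableEq ι] (u : ι → ℂ),
    (∀ i j, theta1 τ (-(u i + u j)) ≠ 0) → ∀ ζ : ℂ,
    theta1 τ ζ * (Matrix.of fun i j =>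
        theta1 τ (ζ - (u i + u j)) / theta1 τ (-(u i + u j))).det =
      theta1 τ ζ ^ Fintype.card ι * theta1 τ (ζ - 2 * ∑ i, u i) *
        ((-1) ^ (Fintype.card ι).choose 2 * ∏ i, ∏ j,
          (if i = j then 1 else theta1 τ (u i - u j)) / theta1 τ (-(u i + u j))) := by
  refine Fintype.induction_empty_option (P := fun ι _ => ∀ [DecidableEq ι] (u : ι → ℂ),
    (∀ i j, theta1 τ (-(u i + u j)) ≠ 0) → ∀ ζ : ℂ,
    theta1 τ ζ * (Matrix.of fun i j =>
        theta1 τ (ζ - (u i + u j)) / theta1 τ (-(u i + u j))).det =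
      theta1 τ ζ ^ Fintype.card ι * theta1 τ (ζ - 2 * ∑ i, u i) *
        ((-1) ^ (Fintype.card ι).choose 2 * ∏ i, ∏ j,
          (if i = j then 1 else theta1 τ (u i - u j)) / theta1 τ (-(u i + u j)))) ?_ ?_ ?_ ι
  · intro α β _ e ih _ u hu ζ
    classical
    let _ : Fintype α := Fintype.ofEquiv β e.symm
    have h := ih (u ∘ e) (fun i j => hu _ _) ζ
    have hc : Fintype.card α = Fintype.card β := Fintype.card_congr e
    rw [← Matrix.det_submatrix_equiv_self e, ← hc, ← e.sum_comp, ← e.prod_comp]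
    simp_rw [← e.prod_comp (fun j => _ / theta1 τ (-(_ + u j))), e.apply_eq_iff_eq]
    exact h
  · intro _ u _ ζ
    simp
  · intro α _ ih _ u hu
    classical
    -- The Schur step needs a nonzero pivot, hence generic ζ; density removes this restriction at
    -- the end.
    have key : ∀ ζ, theta1 τ ζ ≠ 0 → theta1 τ (ζ - 2 * u none) ≠ 0 →
        theta1 τ ζ * (Matrix.of fun i j =>
          theta1 τ (ζ - (u i + u j)) / theta1 τ (-(u i + u j))).det =
        theta1 τ ζ ^ Fintype.card (Option α) * theta1 τ (ζ - 2 * ∑ i, u i) *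
          ((-1) ^ (Fintype.card (Option α)).choose 2 * ∏ i, ∏ j,
          (if i = j then 1 else theta1 τ (u i - u j)) / theta1 τ (-(u i + u j))) := by
      intro ζ h1 h2
      have h00 : theta1 τ (-(2 * u none)) ≠ 0 := by
        have := hu none none
        rwa [← two_mul] at this
      set r : α → ℂ := fun i =>
        theta1 τ (u none - u (some i)) / theta1 τ (-(u (some i) + u none)) with hr
      have hpiv : theta1 τ (ζ - (u none + u none)) / theta1 τ (-(u none + u none)) ≠ 0 := by
        rw [← two_mul]
        exact div_ne_zero h2 h00
      have hih := ih (fun i => u (some i)) (fun i j => hu _ _) (ζ - 2 * u none)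
      -- By the 2 × 2 case, the Schur complement is the same matrix at ζ - 2 u(none), with rows and
      -- columns rescaled.
      have hschur : (Matrix.of fun i j : α =>
          theta1 τ (ζ - (u (some i) + u (some j))) / theta1 τ (-(u (some i) + u (some j)))
          - theta1 τ (ζ - (u (some i) + u none)) / theta1 τ (-(u (some i) + u none))
            * (theta1 τ (ζ - (u none + u (some j))) / theta1 τ (-(u none + u (some j))))
            / (theta1 τ (ζ - (u none + u none)) / theta1 τ (-(u none + u none)))) =
          Matrix.of fun i j : α => (theta1 τ ζ / theta1 τ (ζ - 2 * u none) * r i) *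
            Matrix.of (fun i j : α => r j * Matrix.of (fun i j : α =>
              theta1 τ (ζ - 2 * u none - (u (some i) + u (some j)))
                / theta1 τ (-(u (some i) + u (some j)))) i j) i j := by
        ext i j
        have hf := theta1_frobenius_two hτ ζ (-u (some i)) (-u none) (u (some j)) (u none)
        have a1 := hu (some i) (some j)
        have a2 := hu (some i) none
        have a3 := hu none (some j)
        have a4 := hu (some j) none
        simp only [Matrix.of_apply, hr]
        rw [show -(u (some j) + u none) = -(u none + u (some j)) by ring, ← two_mul (u none)]
        rw [show ζ + -u (some i) - u (some j) = ζ - (u (some i) + u (some j)) by ring,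
          show ζ + -u none - u none = ζ - 2 * u none by ring,
          show -u (some i) - u none = -(u (some i) + u none) by ring,
          show -u none - u (some j) = -(u none + u (some j)) by ring,
          show ζ + -u (some i) - u none = ζ - (u (some i) + u none) by ring,
          show ζ + -u none - u (some j) = ζ - (u none + u (some j)) by ring,
          show -u (some i) - u (some j) = -(u (some i) + u (some j)) by ring,
          show -u none - u none = -(2 * u none) by ring,
          show ζ + -u (some i) + -u none - u (some j) - u none
            = ζ - 2 * u none - (u (some i) + u (some j)) by ring,
          show -u (some i) - -u none = u none - u (some i) by ring] at hf
        generalize theta1 τ (ζ - 2 * u none) = t₁ at hf h2 ⊢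
        generalize theta1 τ (-(2 * u none)) = t₂ at hf h00 ⊢
        generalize theta1 τ (ζ - 2 * u none - (u (some i) + u (some j))) = t₃ at hf ⊢
        field_simp
        linear_combination hf
      have hprod : (∏ i : Option α, ∏ j : Option α,
          (if i = j then 1 else theta1 τ (u i - u j)) / theta1 τ (-(u i + u j))) =
          (theta1 τ (-(2 * u none)))⁻¹ * ((-1) ^ Fintype.card α * ((∏ i, r i) * ∏ i, r i)) *
          ∏ i : α, ∏ j : α, (if i = j then 1 else theta1 τ (u (some i) - u (some j)))
            / theta1 τ (-(u (some i) + u (some j))) := by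
        have e1 : ∀ i : α, theta1 τ (u none - u (some i)) / theta1 τ (-(u none + u (some i)))
            = r i := fun i => by rw [hr, add_comm]
        have e2 : ∀ i : α, theta1 τ (u (some i) - u none) / theta1 τ (-(u (some i) + u none))
            = (-1) * r i := fun i => by
          rw [hr, ← neg_sub, theta1_neg]
          ring
        simp only [Fintype.prod_option, Option.some_inj, reduceCtorEq, if_false, if_true, e1, e2,
          Finset.prod_mul_distrib, Finset.prod_const, Finset.card_univ]
        rw [← two_mul (u none)]
        ring
      rw [det_option (Matrix.of fun i j : Option α =>
        theta1 τ (ζ - (u i + u j)) / theta1 τ (-(u i + u j))) hpiv]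
      simp only [Matrix.of_apply]
      rw [hschur, Matrix.det_mul_column, Matrix.det_mul_row, hprod, Fintype.card_option,
        Fintype.sum_option, Finset.prod_mul_distrib, Finset.prod_const, Finset.card_univ,
        Nat.choose_succ_succ, Nat.choose_one_right, ← two_mul (u none)]
      have harg : ζ - 2 * (u none + ∑ i, u (some i)) = ζ - 2 * u none - 2 * ∑ i, u (some i) := by
        ring
      rw [harg, div_pow]
      have hs : ((-1 : ℂ) ^ Fintype.card α) * (-1) ^ Fintype.card α = 1 := by
        rw [← mul_pow]
        simp
      rw [pow_succ, pow_add]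
      generalize ((-1 : ℂ) ^ Fintype.card α) = s at hs ⊢
      field_simp
      generalize (∏ i : α, ∏ j : α, (if i = j then 1 else theta1 τ (u (some i) - u (some j)))
            / theta1 τ (-(u (some i) + u (some j)))) = p at hih ⊢
      linear_combination (∏ i, r i) ^ 2 * hih - (theta1 τ (ζ - 2 * u none) ^ Fintype.card α *
        (∏ i, r i) ^ 2 * theta1 τ (ζ - 2 * u none - 2 * ∑ i, u (some i)) * p *
        (-1) ^ (Fintype.card α).choose 2) * hs
    have hcont : ∀ a : ℂ, Continuous fun ζ => theta1 τ (ζ - a) := fun a =>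
      (differentiable_theta1 hτ).continuous.comp (continuous_id.sub continuous_const)
    have hc0 : Continuous fun ζ => theta1 τ ζ := (differentiable_theta1 hτ).continuous
    -- Both sides are continuous in ζ, so agreement on a dense set suffices.
    have hd : Dense ({ζ : ℂ | theta1 τ (ζ + 0) ≠ 0} ∩ {ζ | theta1 τ (ζ + -(2 * u none)) ≠ 0}) := by
      refine (dense_theta1_ne_zero hτ hw _).inter_of_isOpen_left (dense_theta1_ne_zero hτ hw _) ?_
      exact isOpen_ne_fun (hc0.comp (continuous_id.add continuous_const)) continuous_const
    refine congrFun (Continuous.ext_on hd ?_ ?_ ?_)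
    · refine hc0.mul (Continuous.matrix_det ?_)
      exact continuous_matrix fun i j => (hcont _).div_const _
    · exact ((hc0.pow _).mul (hcont _)).mul continuous_const
    · rintro ζ ⟨h1, h2⟩
      exact key ζ (by simpa using h1) (by simpa [sub_eq_add_neg] using h2)

/-! ### Signs and the coefficients C_j -/

theorem sum_Icc_one_eq_bigN (ℓ : ℕ) : ∑ m ∈ Finset.Icc 1 ℓ, m = bigN ℓ := by
  have h : 2 * ∑ m ∈ Finset.Icc 1 ℓ, m = ℓ * (ℓ + 1) := by
    induction ℓ with
    | zero => rfl
    | succ n ih =>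
      rw [Finset.sum_Icc_succ_top (by omega), mul_add, ih]
      ring
  unfold bigN
  omega

theorem two_mul_bigN (ℓ : ℕ) : 2 * bigN ℓ = ℓ * (ℓ + 1) :=
  Nat.mul_div_cancel' (Nat.even_mul_succ_self ℓ).two_dvd

/-- A form of κ free of division and subtraction, for parity computations. -/
theorem two_mul_kappa_add (ℓ : ℕ) (J : Finset ℕ) :
    2 * kappa ℓ J + J.card = 2 * (J.card * ℓ) + J.card * J.card := by
  have h : 2 * (J.card * (J.card - 1) / 2) = J.card * (J.card - 1) :=
    Nat.mul_div_cancel' (Nat.even_mul_pred_self _).two_dvd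
  have h2 : J.card * (J.card - 1) + J.card = J.card * J.card := by
    cases J.card with
    | zero => rfl
    | succ n => simp only [Nat.add_sub_cancel]; ring
  unfold kappa
  omega

theorem ellNum_neg (τ η : ℂ) (k : ℤ) : ellNum τ η (-k) = -ellNum τ η k := by
  rw [ellNum, ellNum, ← theta1_neg]
  congr 1
  push_cast
  ring

theorem ellNum_ne_zero {ℓ : ℕ} {τ η : ℂ}
    (hη : ∀ k : ℕ, 1 ≤ k → k ≤ 2 * ℓ → theta1 τ (2 * (k : ℂ) * η) ≠ 0) {k : ℤ}
    (h0 : k ≠ 0) (h1 : k.natAbs ≤ 2 * ℓ) : ellNum τ η k ≠ 0 := by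
  have h : ellNum τ η (k.natAbs : ℤ) ≠ 0 := by
    simpa [ellNum] using hη k.natAbs (by omega) h1
  rcases Int.natAbs_eq k with hk | hk
  · rwa [← hk] at h
  · rw [hk, ellNum_neg]
    exact neg_ne_zero.2 h

theorem curveCoeff_zero (ℓ : ℕ) (τ η : ℂ) : curveCoeff ℓ τ η 0 = 1 := by
  unfold curveCoeff
  have h : ((Finset.Icc 1 ℓ).powerset.filter fun J => ∑ m ∈ J, m = 0) = {∅} := by
    ext J
    simp only [Finset.mem_filter, Finset.mem_powerset, Finset.mem_singleton,
      Finset.sum_eq_zero_iff]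
    constructor
    · rintro ⟨h1, h2⟩
      refine Finset.eq_empty_of_forall_notMem fun m hm => ?_
      have := (Finset.mem_Icc.1 (h1 hm)).1
      have := h2 m hm
      omega
    · rintro rfl
      simp
  rw [h]
  simp [kappa]

/-- Complementation J ↦ Λ∖J sends ‖J‖ to N - ‖J‖ and negates each of the |J||Λ∖J| factors; the
change in κ compensates. -/
theorem curveCoeff_symm (ℓ : ℕ) (τ η : ℂ) {j : ℕ} (hj : j ≤ bigN ℓ) :
    curveCoeff ℓ τ η j = curveCoeff ℓ τ η (bigN ℓ - j) := by
  have hsplit : ∀ J ⊆ Finset.Icc 1 ℓ, ∑ m ∈ Finset.Icc 1 ℓ \ J, m + ∑ m ∈ J, m = bigN ℓ :=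
    fun J hJ => by rw [Finset.sum_sdiff hJ, sum_Icc_one_eq_bigN]
  unfold curveCoeff
  refine Finset.sum_nbij' (fun J => Finset.Icc 1 ℓ \ J) (fun J => Finset.Icc 1 ℓ \ J) ?_ ?_ ?_ ?_ ?_
  · intro J hJ
    simp only [Finset.mem_filter, Finset.mem_powerset] at hJ ⊢
    have := hsplit J hJ.1
    exact ⟨Finset.sdiff_subset, by omega⟩
  · intro J hJ
    simp only [Finset.mem_filter, Finset.mem_powerset] at hJ ⊢
    have := hsplit J hJ.1
    exact ⟨Finset.sdiff_subset, by omega⟩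
  · intro J hJ
    simp only [Finset.mem_filter, Finset.mem_powerset] at hJ
    exact Finset.sdiff_sdiff_eq_self hJ.1
  · intro J hJ
    simp only [Finset.mem_filter, Finset.mem_powerset] at hJ
    exact Finset.sdiff_sdiff_eq_self hJ.1
  · intro J hJ
    simp only [Finset.mem_filter, Finset.mem_powerset] at hJ
    simp only [Finset.sdiff_sdiff_eq_self hJ.1]
    have hcard : (Finset.Icc 1 ℓ \ J).card + J.card = ℓ := by
      rw [Finset.card_sdiff_add_card_eq_card hJ.1]
      simp
    have hfac : ∀ k k' : ℕ, ellNum τ η ((k : ℤ) + k') / ellNum τ η ((k : ℤ) - k') =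
        (-1) * (ellNum τ η ((k' : ℤ) + k) / ellNum τ η ((k' : ℤ) - k)) := fun k k' => by
      rw [← neg_sub, ellNum_neg, add_comm, div_neg]
      ring
    rw [Finset.prod_congr rfl fun k _ => Finset.prod_congr rfl fun k' _ => hfac k k',
      Finset.prod_comm]
    simp only [Finset.prod_mul_distrib, Finset.prod_const]
    rw [← mul_assoc, ← pow_mul, ← pow_add]
    congr 1
    refine neg_one_pow_congr (Nat.even_add.1 ?_)
    -- The two sign exponents add up to κ(J) + κ(Λ∖J) + |J||Λ∖J| + N = 2ℓ².
    refine ⟨ℓ * ℓ, ?_⟩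
    have h1 := two_mul_kappa_add ℓ J
    have h2 := two_mul_kappa_add ℓ (Finset.Icc 1 ℓ \ J)
    have h3 := two_mul_bigN ℓ
    generalize kappa ℓ J = x at *
    generalize kappa ℓ (Finset.Icc 1 ℓ \ J) = y at *
    generalize (Finset.Icc 1 ℓ \ J).card = b at *
    generalize J.card = a at *
    obtain ⟨d, hd⟩ := Nat.exists_eq_add_of_le hj
    rw [hd] at h3 ⊢
    rw [Nat.add_sub_cancel_left]
    subst hcard
    nlinarith

/-! ### Principal minors of G -/

/-- The scalar factor of row `m` of `Gentry` combines with row `m` of the Cauchy product. -/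
theorem row_factor_mul_prod {ℓ : ℕ} {τ η : ℂ}
    (hη : ∀ k : ℕ, 1 ≤ k → k ≤ 2 * ℓ → theta1 τ (2 * (k : ℂ) * η) ≠ 0)
    {J : Finset ℕ} (hJ : J ⊆ Finset.Icc 1 ℓ) {m : ℕ} (hm : m ∈ J) :
    ((-1) ^ (ℓ + 1) * ellNum τ η (2 * (m : ℤ)) * ∏ j ∈ (Finset.Icc 1 ℓ).erase m,
        ellNum τ η ((m : ℤ) + (j : ℤ)) / ellNum τ η ((m : ℤ) - (j : ℤ))) *
      ∏ n ∈ J, (if m = n then 1 else ellNum τ η ((m : ℤ) - (n : ℤ))) /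
        -ellNum τ η ((m : ℤ) + (n : ℤ)) =
    (-1) ^ (ℓ + 1 + J.card) * ∏ k' ∈ Finset.Icc 1 ℓ \ J,
      ellNum τ η ((m : ℤ) + (k' : ℤ)) / ellNum τ η ((m : ℤ) - (k' : ℤ)) := by
  have hU : (Finset.Icc 1 ℓ).erase m = (Finset.Icc 1 ℓ \ J) ∪ J.erase m := by
    ext k
    simp only [Finset.mem_erase, Finset.mem_union, Finset.mem_sdiff]
    by_cases hk : k ∈ J
    · simp [hk, hJ hk]
    · have : k ≠ m := fun h => hk (h ▸ hm)
      simp [hk, this]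
  have hdis : Disjoint (Finset.Icc 1 ℓ \ J) (J.erase m) :=
    Finset.disjoint_left.2 fun k h1 h2 =>
      (Finset.mem_sdiff.1 h1).2 (Finset.mem_of_mem_erase h2)
  have hmb := Finset.mem_Icc.1 (hJ hm)
  have hmm : ellNum τ η (2 * (m : ℤ)) ≠ 0 := ellNum_ne_zero hη (by omega) (by omega)
  -- Each n ∈ J∖{m} leaves a factor -1. The diagonal factor 1/(-[2m]) cancels [2m] and leaves one
  -- more, so the row sign is (-1)^{|J|}.
  have hcancel : (∏ n ∈ J.erase m, ellNum τ η ((m : ℤ) + n) / ellNum τ η ((m : ℤ) - n)) *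
      ∏ n ∈ J.erase m, (if m = n then 1 else ellNum τ η ((m : ℤ) - (n : ℤ))) /
        -ellNum τ η ((m : ℤ) + (n : ℤ)) = (-1) ^ (J.card - 1) := by
    rw [← Finset.prod_mul_distrib, ← Finset.card_erase_of_mem hm, ← Finset.prod_const]
    refine Finset.prod_congr rfl fun n hn => ?_
    obtain ⟨hne, hnJ⟩ := Finset.mem_erase.1 hn
    have hnb := Finset.mem_Icc.1 (hJ hnJ)
    have h1 : ellNum τ η ((m : ℤ) + n) ≠ 0 := ellNum_ne_zero hη (by omega) (by omega)
    have h2 : ellNum τ η ((m : ℤ) - n) ≠ 0 := ellNum_ne_zero hη (by omega) (by omega)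
    rw [if_neg (Ne.symm hne)]
    field_simp
  have hcard : J.card = J.card - 1 + 1 := by
    have := Finset.card_pos.2 ⟨m, hm⟩
    omega
  rw [hU, Finset.prod_union hdis, ← Finset.mul_prod_erase J _ hm, if_pos rfl, ← two_mul (m : ℤ),
    pow_add (-1 : ℂ) (ℓ + 1), hcard, pow_succ (-1 : ℂ) (J.card - 1), ← hcancel]
  field_simp

theorem theta1_mul_det_minor {ℓ : ℕ} {τ η : ℂ} (hτ : 0 < τ.im)
    (hη : ∀ k : ℕ, 1 ≤ k → k ≤ 2 * ℓ → theta1 τ (2 * (k : ℂ) * η) ≠ 0)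
    {ζ : ℂ} (hζ : theta1 τ ζ ≠ 0) {J : Finset ℕ} (hJ : J ⊆ Finset.Icc 1 ℓ) :
    theta1 τ ζ * (Matrix.of fun m n : J => Gentry ℓ τ η ζ m n).det =
      theta1 τ (ζ - 4 * ((∑ m ∈ J, m : ℕ) : ℂ) * η) * ((-1) ^ kappa ℓ J *
        ∏ k ∈ J, ∏ k' ∈ Finset.Icc 1 ℓ \ J,
          ellNum τ η ((k : ℤ) + (k' : ℤ)) / ellNum τ η ((k : ℤ) - (k' : ℤ))) := by
  set u : J → ℂ := fun m => 2 * ((m : ℕ) : ℂ) * η with hu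
  have hsum : ∀ m n : J, theta1 τ (-(u m + u n)) = -ellNum τ η ((m : ℕ) + (n : ℕ) : ℤ) := by
    intro m n
    rw [theta1_neg, ellNum]
    congr 2
    simp only [hu]
    push_cast
    ring
  have hdiff : ∀ m n : J, theta1 τ (u m - u n) = ellNum τ η ((m : ℕ) - (n : ℕ) : ℤ) := by
    intro m n
    rw [ellNum]
    congr 1
    simp only [hu]
    push_cast
    ring
  have hne : ∀ m n : J, theta1 τ (-(u m + u n)) ≠ 0 := by
    intro m n
    rw [hsum]
    have h1 := Finset.mem_Icc.1 (hJ m.2)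
    have h2 := Finset.mem_Icc.1 (hJ n.2)
    exact neg_ne_zero.2 (ellNum_ne_zero hη (by omega) (by omega))
  have hF := theta1_mul_det_cauchy hτ hζ J u hne ζ
  set A : J → ℂ := fun m => (-1) ^ (ℓ + 1) * ellNum τ η (2 * ((m : ℕ) : ℤ)) *
    ∏ j ∈ (Finset.Icc 1 ℓ).erase m,
      ellNum τ η (((m : ℕ) : ℤ) + (j : ℤ)) / ellNum τ η (((m : ℕ) : ℤ) - (j : ℤ)) with hA
  have hG : (Matrix.of fun m n : J => Gentry ℓ τ η ζ m n) =
      Matrix.of fun m n : J => (A m * (theta1 τ ζ)⁻¹) * (Matrix.of fun m n : J =>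
        theta1 τ (ζ - (u m + u n)) / theta1 τ (-(u m + u n))) m n := by
    ext m n
    have e1 : -2 * (((m : ℕ) : ℂ) + ((n : ℕ) : ℂ)) * η = -(u m + u n) := by
      simp only [hu]
      ring
    simp only [Matrix.of_apply, Gentry, Phi, e1, hA, ← sub_eq_add_neg]
    field_simp
  rw [hG, Matrix.det_mul_column, mul_left_comm, hF, Finset.prod_mul_distrib, Finset.prod_const,
    Finset.card_univ]
  have harg : 2 * ∑ i, u i = 4 * ((∑ m ∈ J, m : ℕ) : ℂ) * η := by
    simp only [hu]
    rw [Finset.sum_coe_sort J fun m : ℕ => 2 * (m : ℂ) * η, ← Finset.sum_mul, ← Finset.mul_sum]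
    push_cast
    ring
  have hprod : (∏ m, A m) * ∏ m, ∏ n, (if m = n then 1 else theta1 τ (u m - u n)) /
      theta1 τ (-(u m + u n)) = ((-1) ^ (ℓ + 1 + J.card)) ^ J.card *
        ∏ k ∈ J, ∏ k' ∈ Finset.Icc 1 ℓ \ J,
          ellNum τ η ((k : ℤ) + (k' : ℤ)) / ellNum τ η ((k : ℤ) - (k' : ℤ)) := by
    simp only [hsum, hdiff, Subtype.ext_iff]
    rw [← Finset.prod_mul_distrib, ← Finset.prod_const, ← Finset.prod_mul_distrib,
      ← Finset.prod_coe_sort J]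
    refine Finset.prod_congr rfl fun m _ => ?_
    rw [← row_factor_mul_prod hη hJ m.2, hA]
    congr 1
    exact Finset.prod_coe_sort J fun n : ℕ =>
      (if (m : ℕ) = n then 1 else ellNum τ η (((m : ℕ) : ℤ) - (n : ℤ))) /
        -ellNum τ η (((m : ℕ) : ℤ) + (n : ℤ))
  -- The exponents differ by |J|(|J| + 1), which is even.
  have hsign : ((-1 : ℂ) ^ (ℓ + 1 + J.card)) ^ J.card * (-1) ^ J.card.choose 2 =
      (-1) ^ kappa ℓ J := by
    rw [← pow_mul, ← pow_add, Nat.choose_two_right, kappa]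
    refine neg_one_pow_congr ?_
    have h : (ℓ + 1 + J.card) * J.card + J.card * (J.card - 1) / 2 =
      J.card * (J.card + 1) + (J.card * ℓ + J.card * (J.card - 1) / 2) := by ring
    rw [h, Nat.even_add]
    simp [Nat.even_mul_succ_self]
  have hcancel : theta1 τ ζ ^ J.card * (theta1 τ ζ)⁻¹ ^ J.card = 1 := by
    rw [← mul_pow, mul_inv_cancel₀ hζ, one_pow]
  rw [harg, Fintype.card_coe, ← hsign, mul_right_comm _ (_ ^ J.card.choose 2), ← hprod]
  linear_combination ((∏ m, A m) * (∏ m, ∏ n, (if m = n then 1 else theta1 τ (u m - u n)) /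
      theta1 τ (-(u m + u n))) * (-1) ^ J.card.choose 2 *
    theta1 τ (ζ - 4 * ((∑ m ∈ J, m : ℕ) : ℂ) * η)) * hcancel

/-! ### Assembling the curve equation -/

theorem theta1_mul_det_curveMatrix {ℓ : ℕ} {τ η : ℂ} (hτ : 0 < τ.im)
    (hη : ∀ k : ℕ, 1 ≤ k → k ≤ 2 * ℓ → theta1 τ (2 * (k : ℂ) * η) ≠ 0)
    {ζ : ℂ} (K : ℂ) (hζ : theta1 τ ζ ≠ 0) :
    theta1 τ ζ * (curveMatrix ℓ τ η ζ K).det = curvePoly ℓ τ η ζ K := by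
  let e : Fin ℓ ↪ ℕ := ⟨fun i => (i : ℕ) + 1, fun i j h => Fin.ext (Nat.succ_injective h)⟩
  have hei : ∀ i, e i = (i : ℕ) + 1 := fun _ => rfl
  have he : Finset.univ.map e = Finset.Icc 1 ℓ := by
    ext k
    simp only [Finset.mem_map, Finset.mem_univ, true_and, Finset.mem_Icc]
    constructor
    · rintro ⟨i, rfl⟩
      have := i.2
      rw [hei]
      omega
    · rintro ⟨h1, h2⟩
      exact ⟨⟨k - 1, by omega⟩, by rw [hei]; simp only; omega⟩
  have hM : curveMatrix ℓ τ η ζ K = Matrix.diagonal (fun i => K ^ (2 * e i)) +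
      Matrix.of fun i j => Gentry ℓ τ η ζ (e i) (e j) := by
    ext i j
    simp [curveMatrix, Matrix.diagonal_apply, hei]
  have hterm : ∀ J ∈ (Finset.Icc 1 ℓ).powerset, ∑ m ∈ J, m ∈ Finset.range (bigN ℓ + 1) := by
    intro J hJ
    rw [Finset.mem_range, Nat.lt_succ_iff, ← sum_Icc_one_eq_bigN]
    exact Finset.sum_le_sum_of_subset (Finset.mem_powerset.1 hJ)
  have hpoly : curvePoly ℓ τ η ζ K = ∑ J ∈ (Finset.Icc 1 ℓ).powerset,
      (theta1 τ ζ * (Matrix.of fun m n : J => Gentry ℓ τ η ζ m n).det) *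
        K ^ (2 * (bigN ℓ - ∑ m ∈ J, m)) := by
    rw [← Finset.sum_fiberwise_of_maps_to hterm, curvePoly]
    refine Finset.sum_congr rfl fun j _ => ?_
    rw [curveCoeff, Finset.mul_sum, Finset.sum_mul, Finset.sum_mul]
    refine Finset.sum_congr rfl fun J hJ => ?_
    obtain ⟨hJ1, rfl⟩ := Finset.mem_filter.1 hJ
    rw [theta1_mul_det_minor hτ hη hζ (Finset.mem_powerset.1 hJ1), pow_add]
    -- The sign (-1)^j of the polynomial cancels the one built into C_j.
    have hs : ((-1 : ℂ) ^ ∑ m ∈ J, m) * (-1) ^ ∑ m ∈ J, m = 1 := by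
      rw [← mul_pow]
      simp
    generalize (-1 : ℂ) ^ ∑ m ∈ J, m = s at hs ⊢
    generalize (∏ k ∈ J, ∏ k' ∈ Finset.Icc 1 ℓ \ J, _ : ℂ) = p
    linear_combination (p * (-1) ^ kappa ℓ J *
      theta1 τ (ζ - 4 * ((∑ m ∈ J, m : ℕ) : ℂ) * η) * K ^ (2 * (bigN ℓ - ∑ m ∈ J, m))) * hs
  rw [hpoly, hM, det_diagonal_add_eq_sum_minors, Finset.mul_sum]
  refine Finset.sum_nbij (fun s => s.map e) ?_ ?_ ?_ ?_
  · intro s _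
    rw [Finset.mem_powerset, ← he]
    exact Finset.map_subset_map.2 (Finset.subset_univ s)
  · exact (Finset.map_injective e).injOn
  · intro J hJ
    rw [Finset.mem_coe, Finset.mem_powerset, ← he, Finset.subset_map_iff] at hJ
    obtain ⟨s, -, rfl⟩ := hJ
    exact ⟨s, by simp, rfl⟩
  · intro s _
    have hdet : ((Matrix.of fun i j => Gentry ℓ τ η ζ (e i) (e j)).submatrix
        (Subtype.val : s → Fin ℓ) (Subtype.val : s → Fin ℓ)).det =
        (Matrix.of fun m n : s.map e => Gentry ℓ τ η ζ m n).det := by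
      have hb : Function.Bijective fun i : s =>
          (⟨e i, Finset.mem_map_of_mem e i.2⟩ : s.map e) := by
        refine ⟨fun i j h => Subtype.ext (e.injective (congrArg Subtype.val h)), fun m => ?_⟩
        obtain ⟨i, hi, hm⟩ := Finset.mem_map.1 m.2
        exact ⟨⟨i, hi⟩, Subtype.ext hm⟩
      rw [← Matrix.det_submatrix_equiv_self (Equiv.ofBijective _ hb)]
      rfl
    have hexp : ∏ i ∈ sᶜ, K ^ (2 * e i) = K ^ (2 * (bigN ℓ - ∑ m ∈ s.map e, m)) := by
      rw [Finset.prod_pow_eq_pow_sum, ← Finset.mul_sum, ← sum_Icc_one_eq_bigN, ← he,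
        Finset.sum_map, Finset.sum_map, ← Finset.sum_compl_add_sum s, Nat.add_sub_cancel]
    rw [hdet, hexp, mul_assoc]

theorem proposition3p1 (ℓ : ℕ) (hℓ : 1 ≤ ℓ) (τ η : ℂ) (hτ : 0 < τ.im)
    (hη : ∀ k : ℕ, 1 ≤ k → k ≤ 2 * ℓ → theta1 τ (2 * (k : ℂ) * η) ≠ 0) :
    (∀ ζ K : ℂ, theta1 τ ζ ≠ 0 →
      ((curveMatrix ℓ τ η ζ K).det = 0 ↔ curvePoly ℓ τ η ζ K = 0)) ∧
    (∀ ζ K : ℂ, theta1 τ ζ ≠ 0 →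
      theta1 τ ζ * (curveMatrix ℓ τ η ζ K).det = curvePoly ℓ τ η ζ K) ∧
    curveCoeff ℓ τ η 0 = 1 ∧
    (∀ j : ℕ, j ≤ bigN ℓ → curveCoeff ℓ τ η j = curveCoeff ℓ τ η (bigN ℓ - j)) := by
  refine ⟨fun ζ K hζ => ?_, fun ζ K hζ => theta1_mul_det_curveMatrix hτ hη K hζ,
    curveCoeff_zero ℓ τ η, fun j hj => curveCoeff_symm ℓ τ η hj⟩
  rw [← theta1_mul_det_curveMatrix hτ hη K hζ, mul_eq_zero, or_iff_right hζ]
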